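/- **Orthogonal regressors.** Let $y_t=\sum_{i=1}^p\beta_{0,i}x_{i,t}+\varepsilon_t$, where the errors $\varepsilon_t$ ($t\in\mathbb Z$) are i.i.d. $N(0,\sigma^2)$ with $\sigma^2>0$, and where $(x_{1,t},\dots,x_{p,t},\varepsilon_t)_{t\in\mathbb Z}$ is a mean-zero stationary vector linear process, i.e. $(x_{1,t},\dots,x_{p,t},\varepsilon_t)'=\sum_{k\in\mathbb Z}A_k\eta_{t-k}$ in mean square, with i.i.d. mean-zero square-integrable random vectors $\eta_t$ and square-summable matrices $A_k$. Assume $E(x_{i,t}\varepsilon_t)=0$ for all $i$, and that $\Sigma_{xx}=(\Sigma_{ij})_{i,j}=E(x_tx_t')$ is positive definite. Let $\mathbb T=\{i:\beta_{0,i}\neq0\}$ be the set of true regressors and $\mathbb M=\{1,\dots,p\}\setminus\mathbb T$ the set of irrelevant ones. Given the sample $t=1,\dots,n$, with $y=(y_1,\dots,y_n)'$ and $X$ the $n\times p$ matrix of regressors, let for $\gamma\in\Gamma=\{0,1\}^p$ $$D_\gamma=\mathrm{diag}(\gamma),\qquad \hat\beta_\gamma=(D_\gamma X'XD_\gamma)^+D_\gamma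 X'y,\qquad \hat\sigma_\gamma^2=n^{-1}\|y-X\hat\beta_\gamma\|^2,\qquad k_\gamma=\sum_i\gamma_i,$$ where $^+$ is the Moore–Penrose inverse, and let $q(\gamma)=\log\hat\sigma_\gamma^2+k_\gamma f(n)/n$, where $f(n)/n\to0$ (BIC is the case $f(n)=\log n$). Define $$\sigma_{Ti}^2=\mathbb E_{\gamma_{-i}}\bigl(\mathbb V_{\gamma_i}(q\mid\gamma_{-i})\bigr),$$ where, conditionally on the sample, $\gamma$ is uniformly distributed on $\Gamma$ and $\gamma_{-i}$ denotes the coordinates of $\gamma$ other than $\gamma_i$. Assume that $\Sigma_{\ell j}=0$ for all $j\in\mathbb T$ and $\ell\in\mathbb M$. Then, as $n\to\infty$, $\sigma_{Ti}^2\to0$ in probability for every $i\in\mathbb M$, and for every $i\in\mathbb T$ there is a constant $c_i>0$, depending only on $p$, $i$, $\beta_0$, $\sigma^2$ and $\Sigma_{xx}$, such that $\sigma_{Ti}^2\to c_i$ in probability. -/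

import Mathlib

open MeasureTheory ProbabilityTheory Filter Topology
open scoped Matrix NNReal ENNReal

namespace RegGSA

noncomputable section

/-! ### The Moore–Penrose generalized inverse of a real matrix -/

/-- The four Penrose equations: `B` is the Moore–Penrose inverse of `A`. -/
structure IsMoorePenrose {m n : Type*} [Fintype m] [Fintype n]
    (A : Matrix m n ℝ) (B : Matrix n m ℝ) : Prop where
  mul_mul_left : A * B * A = A
  mul_mul_right : B * A * B = B
  symm_left : (A * B)ᵀ = A * B
  symm_right : (B * A)ᵀ = B * A

theorem IsMoorePenrose.unique {m n : Type*} [Fintype m] [Fintype n]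
    {A : Matrix m n ℝ} {B C : Matrix n m ℝ}
    (hB : IsMoorePenrose A B) (hC : IsMoorePenrose A C) : B = C := by
  have h1 : A * B = A * C := by
    calc A * B = (A * B)ᵀ := hB.symm_left.symm
      _ = ((A * C) * (A * B))ᵀ := by
          rw [← Matrix.mul_assoc (A * C) A B, hC.mul_mul_left]
      _ = (A * B) * (A * C) := by
          rw [Matrix.transpose_mul, hB.symm_left, hC.symm_left]
      _ = A * C := by rw [← Matrix.mul_assoc (A * B) A C, hB.mul_mul_left]
  have h2 : B * A = C * A := by
    calc B * A = (B * A)ᵀ := hB.symm_right.symm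
      _ = ((B * A) * (C * A))ᵀ := by
          rw [Matrix.mul_assoc B A (C * A), ← Matrix.mul_assoc A C A, hC.mul_mul_left]
      _ = (C * A) * (B * A) := by
          rw [Matrix.transpose_mul, hB.symm_right, hC.symm_right]
      _ = C * A := by rw [Matrix.mul_assoc C A (B * A), ← Matrix.mul_assoc A B A, hB.mul_mul_left]
  calc B = B * A * B := hB.mul_mul_right.symm
    _ = C * A * B := by rw [h2]
    _ = C * (A * B) := Matrix.mul_assoc _ _ _
    _ = C * (A * C) := by rw [h1]
    _ = C * A * C := (Matrix.mul_assoc _ _ _).symm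
    _ = C := hC.mul_mul_right

theorem IsMoorePenrose.exists_of_isSymm {n : Type*} [Fintype n]
    {A : Matrix n n ℝ} (hA : Aᵀ = A) : ∃ B, IsMoorePenrose A B := by
  classical
  have hH : A.IsHermitian := by
    rw [Matrix.IsHermitian, Matrix.conjTranspose_eq_transpose_of_trivial, hA]
  obtain ⟨U, d, hU, hAd⟩ : ∃ (U : Matrix n n ℝ) (d : n → ℝ), Uᵀ * U = 1 ∧
      A = U * Matrix.diagonal d * Uᵀ := by
    refine ⟨hH.eigenvectorUnitary, hH.eigenvalues, ?_, ?_⟩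
    · have := (Matrix.mem_unitaryGroup_iff' (A := (hH.eigenvectorUnitary : Matrix n n ℝ))).1
        hH.eigenvectorUnitary.2
      rwa [Matrix.star_eq_conjTranspose, Matrix.conjTranspose_eq_transpose_of_trivial] at this
    · have := hH.spectral_theorem
      rw [Unitary.conjStarAlgAut_apply, Matrix.star_eq_conjTranspose,
        Matrix.conjTranspose_eq_transpose_of_trivial] at this
      exact this
  have key : ∀ a b : n → ℝ, (U * Matrix.diagonal a * Uᵀ) * (U * Matrix.diagonal b * Uᵀ)
      = U * Matrix.diagonal (fun i => a i * b i) * Uᵀ := by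
    intro a b
    calc (U * Matrix.diagonal a * Uᵀ) * (U * Matrix.diagonal b * Uᵀ)
        = U * Matrix.diagonal a * (Uᵀ * U) * Matrix.diagonal b * Uᵀ := by
          simp only [Matrix.mul_assoc]
      _ = U * (Matrix.diagonal a * Matrix.diagonal b) * Uᵀ := by
          rw [hU, Matrix.mul_one]; simp only [Matrix.mul_assoc]
      _ = _ := by rw [Matrix.diagonal_mul_diagonal]
  have hT : ∀ a : n → ℝ, (U * Matrix.diagonal a * Uᵀ)ᵀ = U * Matrix.diagonal a * Uᵀ := by
    intro a
    simp [Matrix.transpose_mul, Matrix.mul_assoc]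
  refine ⟨U * Matrix.diagonal (fun i => (d i)⁻¹) * Uᵀ, ?_, ?_, ?_, ?_⟩
  · rw [hAd, key, key]; simp [mul_inv_mul_cancel]
  · rw [hAd, key, key]
    congr 3
    funext i
    by_cases h : d i = 0 <;> simp [h]
  · rw [hAd, key, hT]
  · rw [hAd, key, hT]

theorem IsMoorePenrose.exists {m n : Type*} [Fintype m] [Fintype n]
    (A : Matrix m n ℝ) : ∃ B, IsMoorePenrose A B := by
  obtain ⟨G, hG⟩ := IsMoorePenrose.exists_of_isSymm (A := Aᵀ * A) (by simp)
  have hGt : Gᵀ = G := by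
    refine IsMoorePenrose.unique (A := Aᵀ * A) ⟨?_, ?_, ?_, ?_⟩ hG
    · have := congrArg Matrix.transpose hG.mul_mul_left
      simpa [Matrix.mul_assoc] using this
    · have := congrArg Matrix.transpose hG.mul_mul_right
      simpa [Matrix.mul_assoc] using this
    · have := hG.symm_right
      simp only [Matrix.transpose_mul, Matrix.transpose_transpose] at this ⊢
      exact this.symm
    · have := hG.symm_left
      simp only [Matrix.transpose_mul, Matrix.transpose_transpose] at this ⊢
      exact this.symm
  have hA : A * G * Aᵀ * A = A := by
    have h0 : Aᵀ * (A * G * Aᵀ * A - A) = 0 := by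
      have := hG.mul_mul_left
      rw [Matrix.mul_sub, sub_eq_zero]
      simpa [Matrix.mul_assoc] using this
    have h1 : (A * G * Aᵀ * A - A)ᵀ * (A * G * Aᵀ * A - A) = 0 := by
      have h2 : A * G * Aᵀ * A - A = A * (G * Aᵀ * A) - A := by simp [Matrix.mul_assoc]
      have h3 : (A * G * Aᵀ * A - A)ᵀ = (G * Aᵀ * A)ᵀ * Aᵀ - Aᵀ := by
        rw [h2, Matrix.transpose_sub, Matrix.transpose_mul]
      rw [h3, Matrix.sub_mul, Matrix.mul_assoc, h0, Matrix.mul_zero, sub_zero]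
    have h4 : A * G * Aᵀ * A - A = 0 := by
      rw [← Matrix.conjTranspose_eq_transpose_of_trivial] at h1
      exact Matrix.conjTranspose_mul_self_eq_zero.1 h1
    exact sub_eq_zero.1 h4
  refine ⟨G * Aᵀ, ?_, ?_, ?_, ?_⟩
  · rw [← Matrix.mul_assoc, hA]
  · have := congrArg (· * Aᵀ) hG.mul_mul_right
    simpa [Matrix.mul_assoc] using this
  · simp [Matrix.transpose_mul, hGt, Matrix.mul_assoc]
  · have := hG.symm_right
    rw [Matrix.mul_assoc]
    exact this

/-- The Moore–Penrose generalized inverse `A⁺`. -/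
def pinv {m n : Type*} [Fintype m] [Fintype n] (A : Matrix m n ℝ) : Matrix n m ℝ :=
  (IsMoorePenrose.exists A).choose

theorem pinv_spec {m n : Type*} [Fintype m] [Fintype n] (A : Matrix m n ℝ) :
    IsMoorePenrose A (pinv A) :=
  (IsMoorePenrose.exists A).choose_spec

/-! ### Submodels, least squares and information criteria -/

/-- The set `Γ = {0,1}^p` of specifications; `γ i = true` means that regressor `i` is included. -/
abbrev Spec (p : ℕ) : Type := Fin p → Bool

/-- `D_γ = diag(γ)`. -/
def selMatrix {p : ℕ} (γ : Spec p) : Matrix (Fin p) (Fin p) ℝ :=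
  Matrix.diagonal fun i => if γ i then 1 else 0

/-- The number `k_γ` of regressors included in the submodel `γ`. -/
def numReg {p : ℕ} (γ : Spec p) : ℕ := (Finset.univ.filter fun i => γ i = true).card

/-- The least squares estimator `(D_γ X' X D_γ)⁺ D_γ X' y` in the submodel `γ`. -/
def ols {n p : ℕ} (X : Matrix (Fin n) (Fin p) ℝ) (y : Fin n → ℝ) (γ : Spec p) : Fin p → ℝ :=
  (pinv (selMatrix γ * Xᵀ * X * selMatrix γ) * selMatrix γ * Xᵀ) *ᵥ y

/-- The residuals of the submodel `γ`. -/
def resid {n p : ℕ} (X : Matrix (Fin n) (Fin p) ℝ) (y : Fin n → ℝ) (γ : Spec p) : Fin n → ℝ :=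
  y - X *ᵥ ols X y γ

/-- The residual variance `n⁻¹ e_γ' e_γ` of the submodel `γ`, where `e_γ` are its residuals. -/
def residVar {n p : ℕ} (X : Matrix (Fin n) (Fin p) ℝ) (y : Fin n → ℝ) (γ : Spec p) : ℝ :=
  (n : ℝ)⁻¹ * (resid X y γ ⬝ᵥ resid X y γ)

/-- The information criterion with penalty `f`: the logarithm of the residual variance
plus `k_γ f(n) / n`. -/
def infoCrit (f : ℕ → ℝ) {n p : ℕ} (X : Matrix (Fin n) (Fin p) ℝ) (y : Fin n → ℝ)
    (γ : Spec p) : ℝ :=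
  Real.log (residVar X y γ) + (numReg γ : ℝ) * (f n / n)

/-- The penalty of the Bayesian information criterion, for which `infoCrit` is BIC. -/
def bicPenalty (n : ℕ) : ℝ := Real.log n

/-- The penalty of BIC satisfies the condition `f(n) / n → 0`. -/
theorem tendsto_bicPenalty_div :
    Tendsto (fun n : ℕ => bicPenalty n / n) atTop (𝓝 0) :=
  (Real.isLittleO_log_id_atTop.tendsto_div_nhds_zero).comp tendsto_natCast_atTop_atTop

/-! ### The numerator of the total sensitivity index -/

/-- The uniform distribution `P` on `Γ`. -/
def unifSpec (p : ℕ) : Measure (Spec p) := uniformOn Set.univ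

/-- `E_{γ_{-i}}(V_{γ_i}(q ∣ γ_{-i}))` under the uniform distribution on `Γ`: the average over `γ` of
the variance of `q` under the conditional distribution given the coordinates other than `i`. -/
def totalVar {p : ℕ} (q : Spec p → ℝ) (i : Fin p) : ℝ :=
  ∫ γ, Var[q; (unifSpec p)[|{γ' : Spec p | ∀ j, j ≠ i → γ' j = γ j}]] ∂(unifSpec p)

/-! ### The regression process -/

/-- `z` is a (two-sided) vector linear process `z_t = ∑_{k ∈ ℤ} A_k η_{t-k}`, where the `η_t` are
i.i.d. random vectors with mean zero and finite second moments, and the coefficient matrices are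
square summable; the series converges in mean square. -/
def IsLinearProcess {Ω ι : Type*} [MeasurableSpace Ω] (μ : Measure Ω)
    (z : ℤ → Ω → ι → ℝ) : Prop :=
  (∀ t i, MemLp (fun ω => z t ω i) 2 μ) ∧
  ∃ (d : ℕ) (η : ℤ → Ω → Fin d → ℝ) (A : ℤ → Matrix ι (Fin d) ℝ),
    iIndepFun η μ ∧
    (∀ t, IdentDistrib (η t) (η 0) μ μ) ∧
    (∀ t a, MemLp (fun ω => η t ω a) 2 μ ∧ ∫ ω, η t ω a ∂μ = 0) ∧
    (∀ i a, Summable fun k => (A k i a) ^ 2) ∧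
    ∀ t i, Tendsto (fun N : ℕ => eLpNorm (fun ω => z t ω i -
      ∑ k ∈ Finset.Icc (-(N : ℤ)) N, (A k *ᵥ η (t - k) ω) i) 2 μ) atTop (𝓝 0)

/-- The joint process `(x_{1,t}, …, x_{p,t}, ε_t)`. -/
def joint {Ω : Type*} {p : ℕ} (x : ℤ → Ω → Fin p → ℝ) (ε : ℤ → Ω → ℝ) :
    ℤ → Ω → (Fin p ⊕ Unit) → ℝ :=
  fun t ω => Sum.elim (x t ω) (fun _ => ε t ω)

/-- The assumptions on the regressors `x_t` and the errors `ε_t`: jointly they form a linear process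
(so all variables have mean zero), the errors are i.i.d. `N(0, σ²)`, each regressor is
uncorrelated with the contemporaneous error, and `E(x_t x_t') = S`. -/
structure IsRegressionProcess {Ω : Type*} [MeasurableSpace Ω] (μ : Measure Ω) {p : ℕ}
    (S : Matrix (Fin p) (Fin p) ℝ) (σ : ℝ≥0)
    (x : ℤ → Ω → Fin p → ℝ) (ε : ℤ → Ω → ℝ) : Prop where
  linear : IsLinearProcess μ (joint x ε)
  indep : iIndepFun ε μ
  law : ∀ t, HasLaw (ε t) (gaussianReal 0 (σ ^ 2)) μ
  cov_error : ∀ t i, ∫ ω, x t ω i * ε t ω ∂μ = 0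
  cov : ∀ t i j, ∫ ω, x t ω i * x t ω j ∂μ = S i j

/-- The `n × p` matrix of regressors at times `1, …, n`. -/
def design {Ω : Type*} {p : ℕ} (x : ℤ → Ω → Fin p → ℝ) (n : ℕ) (ω : Ω) :
    Matrix (Fin n) (Fin p) ℝ :=
  Matrix.of fun (t : Fin n) i => x ((t : ℤ) + 1) ω i

/-- The sample `y = X β₀ + ε` at times `1, …, n`. -/
def response {Ω : Type*} {p : ℕ} (β₀ : Fin p → ℝ) (x : ℤ → Ω → Fin p → ℝ) (ε : ℤ → Ω → ℝ)
    (n : ℕ) (ω : Ω) : Fin n → ℝ :=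
  design x n ω *ᵥ β₀ + fun t : Fin n => ε ((t : ℤ) + 1) ω

/-- The numerator `σ²_{Ti}` of the total sensitivity index of regressor `i`, computed from the
sample of size `n` with the information criterion with penalty `f`. -/
def sigmaT {Ω : Type*} {p : ℕ} (f : ℕ → ℝ) (β₀ : Fin p → ℝ) (x : ℤ → Ω → Fin p → ℝ)
    (ε : ℤ → Ω → ℝ) (i : Fin p) (n : ℕ) (ω : Ω) : ℝ :=
  totalVar (infoCrit f (design x n ω) (response β₀ x ε n ω)) i

end

end RegGSA

/-! The residual variance of each submodel is a function of the sample second moments of `(x, ε)`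
alone, and this function is continuous at the population moments. A weak law for those moments and
the continuous mapping theorem therefore give the limit of the criterion, the penalty vanishing
because `f n / n → 0`. The total variance is a polynomial in the finitely many values of the
criterion, so it converges as well.

Weak law (`IsLinearProcess.avgTendsto_mul`): products of finite moving averages of i.i.d. noise obey
an L¹ law of large numbers, and stationarity makes the truncation error uniform in time, so the law
passes to mean square limits.

Continuity (`continuousAt_submodelCoef`): the Moore–Penrose inverse is discontinuous in general, but
on a fixed submodel with nonsingular moments it is expressed by an ordinary inverse.

Limit: the criterion tends to `log (b' S b + σ²)`, with `b` the difference between `β₀` and the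
population coefficients of the submodel. Under orthogonality an irrelevant regressor does not change
`b`, so its total variance is zero (`totalVar_limitCrit_eq_zero`). Dropping a true regressor from
the full model makes `b` nonzero, so its total variance is positive (`totalVar_limitCrit_pos`). -/

namespace RegGSA

/-! ### Laws of large numbers in L¹ for time averages -/

section Averages

variable {Ω : Type*} [MeasurableSpace Ω] {μ : Measure Ω}

/-- The averages of the integrable process `u` with constant mean `c` over the times `1, …, n`
converge to `c` in mean. -/
structure AvgTendsto (μ : Measure Ω) (u : ℤ → Ω → ℝ) (c : ℝ) : Prop where
  memLp : ∀ t, MemLp (u t) 1 μ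
  mean : ∀ t, ∫ ω, u t ω ∂μ = c
  tendsto : Tendsto (fun n : ℕ => eLpNorm (fun ω =>
    (n : ℝ)⁻¹ * ∑ t ∈ Finset.range n, u ((t : ℤ) + 1) ω - c) 1 μ) atTop (𝓝 0)

theorem memLp_avg {u : ℤ → Ω → ℝ} (hu : ∀ t, MemLp (u t) 1 μ) (n : ℕ) :
    MemLp (fun ω => (n : ℝ)⁻¹ * ∑ t ∈ Finset.range n, u ((t : ℤ) + 1) ω) 1 μ :=
  (memLp_finsetSum (f := fun t : ℕ => u ((t : ℤ) + 1)) _ fun _ _ => hu _).const_mul _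

theorem AvgTendsto.zero : AvgTendsto μ (fun _ _ => 0) 0 where
  memLp _ := MemLp.zero'
  mean _ := by simp
  tendsto := by simp

theorem AvgTendsto.add [IsFiniteMeasure μ] {u v : ℤ → Ω → ℝ} {c d : ℝ} (hu : AvgTendsto μ u c)
    (hv : AvgTendsto μ v d) : AvgTendsto μ (fun t ω => u t ω + v t ω) (c + d) where
  memLp t := (hu.memLp t).add (hv.memLp t)
  mean t := by
    rw [integral_add (memLp_one_iff_integrable.1 (hu.memLp t))
      (memLp_one_iff_integrable.1 (hv.memLp t)), hu.mean, hv.mean]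
  tendsto := by
    have h := hu.tendsto.add hv.tendsto
    rw [add_zero] at h
    refine tendsto_of_tendsto_of_tendsto_of_le_of_le tendsto_const_nhds h (fun _ => zero_le)
      fun n => ?_
    refine le_trans (le_of_eq ?_) (eLpNorm_add_le
      ((memLp_avg hu.memLp n).sub (memLp_const c)).aestronglyMeasurable
      ((memLp_avg hv.memLp n).sub (memLp_const d)).aestronglyMeasurable le_rfl)
    congr 1
    funext ω
    simp only [Finset.sum_add_distrib, Pi.add_apply]
    ring

theorem AvgTendsto.const_mul {u : ℤ → Ω → ℝ} {c : ℝ} (hu : AvgTendsto μ u c) (a : ℝ) :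
    AvgTendsto μ (fun t ω => a * u t ω) (a * c) where
  memLp t := (hu.memLp t).const_mul a
  mean t := by rw [integral_const_mul, hu.mean]
  tendsto := by
    have h := ENNReal.Tendsto.const_mul (a := ‖a‖ₑ) hu.tendsto (Or.inr enorm_ne_top)
    rw [mul_zero] at h
    refine h.congr fun n => ?_
    rw [← eLpNorm_const_smul]
    congr 1
    funext ω
    simp only [← Finset.mul_sum, Pi.smul_apply, smul_eq_mul]
    ring

theorem AvgTendsto.sum [IsFiniteMeasure μ] {κ : Type*} (s : Finset κ) {u : κ → ℤ → Ω → ℝ}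
    (hu : ∀ k, ∃ c, AvgTendsto μ (u k) c) :
    ∃ c, AvgTendsto μ (fun t ω => ∑ k ∈ s, u k t ω) c := by
  classical
  induction s using Finset.induction_on with
  | empty => exact ⟨0, by simpa using AvgTendsto.zero⟩
  | insert k s hk ih =>
    obtain ⟨c, hc⟩ := hu k
    obtain ⟨d, hd⟩ := ih
    refine ⟨c + d, ?_⟩
    simpa only [Finset.sum_insert hk] using hc.add hd

theorem eLpNorm_avg_le {u : ℤ → Ω → ℝ} (hu : ∀ t, MemLp (u t) 1 μ) {δ : ℝ≥0∞}
    (h : ∀ t, eLpNorm (u t) 1 μ ≤ δ) (n : ℕ) :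
    eLpNorm (fun ω => (n : ℝ)⁻¹ * ∑ t ∈ Finset.range n, u ((t : ℤ) + 1) ω) 1 μ ≤ δ := by
  have h1 : (fun ω => (n : ℝ)⁻¹ * ∑ t ∈ Finset.range n, u ((t : ℤ) + 1) ω)
      = (n : ℝ)⁻¹ • ∑ t ∈ Finset.range n, u ((t : ℤ) + 1) := by
    funext ω; simp
  rw [h1, eLpNorm_const_smul]
  rcases Nat.eq_zero_or_pos n with rfl | hn
  · simp
  have h2 : eLpNorm (∑ t ∈ Finset.range n, u ((t : ℤ) + 1)) 1 μ ≤ n * δ := by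
    refine (eLpNorm_sum_le (fun t _ => (hu _).aestronglyMeasurable) le_rfl).trans ?_
    refine (Finset.sum_le_sum fun t _ => h _).trans ?_
    simp
  have hn' : (n : ℝ≥0∞) ≠ 0 := by exact_mod_cast hn.ne'
  have h3 : ‖(n : ℝ)⁻¹‖ₑ = (n : ℝ≥0∞)⁻¹ := by
    rw [enorm_inv (by exact_mod_cast hn.ne')]
    simp
  rw [h3]
  calc (n : ℝ≥0∞)⁻¹ * eLpNorm (∑ t ∈ Finset.range n, u ((t : ℤ) + 1)) 1 μ
      ≤ (n : ℝ≥0∞)⁻¹ * (n * δ) := by gcongr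
    _ = δ := by rw [← mul_assoc, ENNReal.inv_mul_cancel hn' (ENNReal.natCast_ne_top n), one_mul]

/-- Averaging does not increase a bound on the L¹ norm uniform in time, so the law is closed under
uniform L¹ approximation; a three-epsilon argument. -/
theorem AvgTendsto.of_approx [IsProbabilityMeasure μ] {u : ℤ → Ω → ℝ} {c : ℝ} (hu : ∀ t, MemLp (u t) 1 μ)
    (hc : ∀ t, ∫ ω, u t ω ∂μ = c)
    (h : ∀ δ : ℝ≥0∞, 0 < δ → ∃ v d, AvgTendsto μ v d ∧
      ∀ t, eLpNorm (fun ω => u t ω - v t ω) 1 μ ≤ δ) : AvgTendsto μ u c where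
  memLp := hu
  mean := hc
  tendsto := by
    rw [ENNReal.tendsto_atTop_zero]
    intro e he
    have he3 : 0 < e / 3 := ENNReal.div_pos he.ne' (by norm_num)
    obtain ⟨v, d, hv, huv⟩ := h _ he3
    obtain ⟨N, hN⟩ := ENNReal.tendsto_atTop_zero.1 hv.tendsto _ he3
    refine ⟨N, fun n hn => ?_⟩
    -- The approximant may have a different mean, but the two means differ by at most the L¹
    -- distance at time 0.
    have hcd : eLpNorm (fun _ : Ω => d - c) 1 μ ≤ e / 3 := by
      have h1 : c - d = ∫ ω, (u 0 ω - v 0 ω) ∂μ := by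
        rw [integral_sub (memLp_one_iff_integrable.1 (hu 0))
          (memLp_one_iff_integrable.1 (hv.memLp 0)), hc, hv.mean]
      rw [eLpNorm_const _ one_ne_zero (IsProbabilityMeasure.ne_zero μ)]
      simp only [measure_univ, ENNReal.one_rpow, mul_one]
      rw [← enorm_neg, neg_sub, h1]
      refine (enorm_integral_le_lintegral_enorm _).trans ?_
      rw [← eLpNorm_one_eq_lintegral_enorm]
      exact huv 0
    have hdiff : ∀ t, MemLp (fun ω => u t ω - v t ω) 1 μ := fun t => (hu t).sub (hv.memLp t)
    have heq : (fun ω => (n : ℝ)⁻¹ * ∑ t ∈ Finset.range n, u ((t : ℤ) + 1) ω - c)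
        = (fun ω => (n : ℝ)⁻¹ * ∑ t ∈ Finset.range n,
            (u ((t : ℤ) + 1) ω - v ((t : ℤ) + 1) ω)) +
          ((fun ω => (n : ℝ)⁻¹ * ∑ t ∈ Finset.range n, v ((t : ℤ) + 1) ω - d)
            + fun _ => d - c) := by
      funext ω
      simp only [Pi.add_apply, Finset.sum_sub_distrib]
      ring
    rw [heq]
    have m1 := (memLp_avg hdiff n).aestronglyMeasurable
    have m2 := ((memLp_avg hv.memLp n).sub (memLp_const d)).aestronglyMeasurable
    have m3 : AEStronglyMeasurable (fun _ : Ω => d - c) μ := aestronglyMeasurable_const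
    calc _ ≤ _ := eLpNorm_add_le m1 (m2.add m3) le_rfl
      _ ≤ e / 3 + (e / 3 + e / 3) := by
        refine add_le_add (eLpNorm_avg_le hdiff huv n) ((eLpNorm_add_le m2 m3 le_rfl).trans ?_)
        exact add_le_add (hN n hn) hcd
      _ = e := by rw [← add_assoc, ENNReal.add_thirds]

theorem AvgTendsto.tendstoInMeasure {u : ℤ → Ω → ℝ} {c : ℝ} (h : AvgTendsto μ u c) :
    TendstoInMeasure μ (fun (n : ℕ) ω => (n : ℝ)⁻¹ * ∑ t ∈ Finset.range n, u ((t : ℤ) + 1) ω)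
      atTop fun _ => c :=
  tendstoInMeasure_of_tendsto_eLpNorm one_ne_zero
    (fun n => (memLp_avg h.memLp n).aestronglyMeasurable) aestronglyMeasurable_const h.tendsto

/-- Only the diagonal terms of the squared sum survive integration, so the average has second moment
at most `C / n`, and the L² norm dominates the L¹ norm on a probability space. -/
theorem AvgTendsto.of_orthogonal [IsProbabilityMeasure μ] {u : ℤ → Ω → ℝ} {C : ℝ} (hu : ∀ t, MemLp (u t) 2 μ)
    (hmean : ∀ t, ∫ ω, u t ω ∂μ = 0) (hC : ∀ t, ∫ ω, u t ω * u t ω ∂μ ≤ C)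
    (hort : ∀ t s, t ≠ s → ∫ ω, u t ω * u s ω ∂μ = 0) : AvgTendsto μ u 0 where
  memLp t := (hu t).mono_exponent one_le_two
  mean := hmean
  tendsto := by
    have hC0 : 0 ≤ C := le_trans (integral_nonneg fun ω => mul_self_nonneg _) (hC 0)
    have hlim : Tendsto (fun n : ℕ => ENNReal.ofReal (Real.sqrt ((n : ℝ)⁻¹ * C))) atTop (𝓝 0) := by
      have h1 : Tendsto (fun n : ℕ => (n : ℝ)⁻¹ * C) atTop (𝓝 (0 * C)) :=
        tendsto_inv_atTop_nhds_zero_nat.mul_const C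
      have h2 := ENNReal.tendsto_ofReal ((Real.continuous_sqrt.tendsto _).comp h1)
      simpa using h2
    refine tendsto_of_tendsto_of_tendsto_of_le_of_le tendsto_const_nhds hlim (fun _ => zero_le)
      fun n => ?_
    have hS : MemLp (fun ω => (n : ℝ)⁻¹ * ∑ t ∈ Finset.range n, u ((t : ℤ) + 1) ω - 0) 2 μ := by
      simp only [sub_zero]
      exact (memLp_finsetSum (f := fun t : ℕ => u ((t : ℤ) + 1)) _ fun t _ => hu _).const_mul _
    refine (eLpNorm_le_eLpNorm_of_exponent_le one_le_two hS.aestronglyMeasurable).trans ?_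
    rw [hS.eLpNorm_eq_integral_rpow_norm two_ne_zero ENNReal.ofNat_ne_top]
    refine ENNReal.ofReal_le_ofReal ?_
    simp only [ENNReal.toReal_ofNat, Real.rpow_two, Real.norm_eq_abs, sq_abs, sub_zero]
    rw [Real.sqrt_eq_rpow, one_div]
    refine Real.rpow_le_rpow (integral_nonneg fun ω => sq_nonneg _) ?_ (by norm_num)
    have hint : ∀ t s, Integrable (fun ω => u t ω * u s ω) μ :=
      fun t s => (hu t).integrable_mul (hu s)
    have h1 : ∫ ω, ((n : ℝ)⁻¹ * ∑ t ∈ Finset.range n, u ((t : ℤ) + 1) ω) ^ 2 ∂μ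
        = ((n : ℝ)⁻¹) ^ 2 * ∑ t ∈ Finset.range n, ∑ s ∈ Finset.range n,
          ∫ ω, u ((t : ℤ) + 1) ω * u ((s : ℤ) + 1) ω ∂μ := by
      have : ∀ ω, ((n : ℝ)⁻¹ * ∑ t ∈ Finset.range n, u ((t : ℤ) + 1) ω) ^ 2
          = ((n : ℝ)⁻¹) ^ 2 * ∑ t ∈ Finset.range n, ∑ s ∈ Finset.range n,
            u ((t : ℤ) + 1) ω * u ((s : ℤ) + 1) ω := by
        intro ω
        rw [mul_pow, sq (∑ t ∈ Finset.range n, u ((t : ℤ) + 1) ω), Finset.sum_mul_sum]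
      simp_rw [this]
      rw [integral_const_mul, integral_finsetSum _ fun t _ => integrable_finsetSum _ fun s _ =>
        hint _ _]
      simp_rw [integral_finsetSum _ fun s _ => hint _ _]
    rw [h1]
    have h2 : ∑ t ∈ Finset.range n, ∑ s ∈ Finset.range n,
          ∫ ω, u ((t : ℤ) + 1) ω * u ((s : ℤ) + 1) ω ∂μ ≤ n * C := by
      have : ∀ t ∈ Finset.range n, ∑ s ∈ Finset.range n,
          ∫ ω, u ((t : ℤ) + 1) ω * u ((s : ℤ) + 1) ω ∂μ ≤ C := by
        intro t ht
        rw [Finset.sum_eq_single_of_mem t ht]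
        · exact hC _
        · intro s _ hst
          exact hort _ _ fun h => hst (by omega)
      refine (Finset.sum_le_sum this).trans ?_
      simp
    rcases Nat.eq_zero_or_pos n with rfl | hn
    · simp
    have hn' : (0 : ℝ) < n := by exact_mod_cast hn
    calc _ ≤ ((n : ℝ)⁻¹) ^ 2 * (n * C) := by gcongr
      _ = (n : ℝ)⁻¹ * C := by field_simp

end Averages

end RegGSA

namespace RegGSA

/-! ### Sample second moments of linear processes -/

section LinearProcess

variable {Ω : Type*} [MeasurableSpace Ω] {μ : Measure Ω} {d : ℕ} {η : ℤ → Ω → Fin d → ℝ}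

/-- `η` is a sequence of i.i.d. random vectors with mean zero and finite second moments. -/
structure IsNoise (μ : Measure Ω) (η : ℤ → Ω → Fin d → ℝ) : Prop where
  indep : iIndepFun η μ
  ident : ∀ t, IdentDistrib (η t) (η 0) μ μ
  memLp : ∀ t a, MemLp (fun ω => η t ω a) 2 μ
  mean : ∀ t a, ∫ ω, η t ω a ∂μ = 0

theorem IsNoise.integral_mul_eq_zero (h : IsNoise μ η) {m : ℤ} {T : Finset ℤ} (hm : m ∉ T)
    (a : Fin d) {g : (T → Fin d → ℝ) → ℝ} (hg : Measurable g) :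
    ∫ ω, η m ω a * g (fun s : T => η s ω) ∂μ = 0 := by
  have hmeas : ∀ t, AEMeasurable (η t) μ := fun t => (h.ident t).aemeasurable_fst
  have h1 := h.indep.indepFun_finset₀ {m} T (by simpa using hm) hmeas
  have h2 : IndepFun (fun ω => η m ω a) (fun ω => g (fun s : T => η s ω)) μ :=
    h1.comp (φ := fun v : ({m} : Finset ℤ) → Fin d → ℝ => v ⟨m, by simp⟩ a) (ψ := g) (by fun_prop) hg
  rw [h2.integral_fun_mul_eq_mul_integral (h.memLp m a).aestronglyMeasurable, h.mean, zero_mul]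
  exact (hg.comp_aemeasurable
    (aemeasurable_pi_lambda _ fun s => hmeas s)).aestronglyMeasurable

theorem IsNoise.indepFun_coord (h : IsNoise μ η) {m l : ℤ} (hml : m ≠ l) (a b : Fin d) :
    IndepFun (fun ω => η m ω a) (fun ω => η l ω b) μ :=
  (h.indep.indepFun hml).comp (φ := fun v : Fin d → ℝ => v a) (ψ := fun v : Fin d → ℝ => v b)
    (by fun_prop) (by fun_prop)

/-- The products are i.i.d. and integrable. Without fourth moments they need not lie in L², so the
L¹ strong law replaces the orthogonality argument. -/
theorem IsNoise.avgTendsto_same (h : IsNoise μ η) [IsProbabilityMeasure μ] (k : ℤ)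
    (a b : Fin d) :
    ∃ c, AvgTendsto μ (fun t ω => η (t - k) ω a * η (t - k) ω b) c := by
  have hprod : Measurable fun v : Fin d → ℝ => v a * v b := by fun_prop
  have hid : ∀ t s, IdentDistrib (fun ω => η t ω a * η t ω b) (fun ω => η s ω a * η s ω b) μ μ :=
    fun t s => ((h.ident t).trans (h.ident s).symm).comp hprod
  have hL : ∀ t, MemLp (fun ω => η t ω a * η t ω b) 1 μ := fun t =>
    memLp_one_iff_integrable.2 ((h.memLp t a).integrable_mul (h.memLp t b))
  refine ⟨∫ ω, η (1 - k) ω a * η (1 - k) ω b ∂μ, fun t => hL _,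
    fun t => (hid _ _).integral_eq, ?_⟩
  have := strong_law_Lp (μ := μ) le_rfl ENNReal.one_ne_top
    (fun (t : ℕ) ω => η ((t : ℤ) + 1 - k) ω a * η ((t : ℤ) + 1 - k) ω b)
    (hL _) (fun t s hts => (h.indep.indepFun
      (show (t : ℤ) + 1 - k ≠ (s : ℤ) + 1 - k by omega)).comp hprod hprod) (fun t => hid _ _)
  simpa using this

/-- At distinct lags the two factors are independent, so the product is square integrable, and
products at different times are orthogonal. -/
theorem IsNoise.avgTendsto_ne (h : IsNoise μ η) [IsProbabilityMeasure μ] {k l : ℤ} (hkl : k ≠ l)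
    (a b : Fin d) : AvgTendsto μ (fun t ω => η (t - k) ω a * η (t - l) ω b) 0 := by
  have hne : ∀ t : ℤ, t - k ≠ t - l := fun t => by omega
  have hsq : ∀ (t : ℤ) (e : Fin d), Integrable (fun ω => η t ω e * η t ω e) μ := fun t e =>
    (h.memLp t e).integrable_mul (h.memLp t e)
  have hind : ∀ t, IndepFun (fun ω => η (t - k) ω a * η (t - k) ω a)
      (fun ω => η (t - l) ω b * η (t - l) ω b) μ := fun t =>
    (h.indepFun_coord (hne t) a b).comp (φ := fun r : ℝ => r * r) (ψ := fun r : ℝ => r * r)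
      (by fun_prop) (by fun_prop)
  have hconst : ∀ (t s : ℤ) (e : Fin d),
      ∫ ω, η t ω e * η t ω e ∂μ = ∫ ω, η s ω e * η s ω e ∂μ := fun t s e =>
    (((h.ident t).trans (h.ident s).symm).comp
      (u := fun v : Fin d → ℝ => v e * v e) (by fun_prop)).integral_eq
  refine AvgTendsto.of_orthogonal
    (C := (∫ ω, η 0 ω a * η 0 ω a ∂μ) * ∫ ω, η 0 ω b * η 0 ω b ∂μ) ?_ ?_ ?_ ?_
  · intro t
    have hm : AEStronglyMeasurable (fun ω => η (t - k) ω a * η (t - l) ω b) μ :=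
      (h.memLp _ _).aestronglyMeasurable.mul (h.memLp _ _).aestronglyMeasurable
    rw [memLp_two_iff_integrable_sq hm]
    refine ((hind t).integrable_mul (hsq _ _) (hsq _ _)).congr (.of_forall fun ω => ?_)
    simp only [Pi.mul_apply]
    ring
  · intro t
    rw [(h.indepFun_coord (hne t) a b).integral_fun_mul_eq_mul_integral
      (h.memLp _ _).aestronglyMeasurable (h.memLp _ _).aestronglyMeasurable, h.mean, zero_mul]
  · intro t
    have h1 : ∀ ω, η (t - k) ω a * η (t - l) ω b * (η (t - k) ω a * η (t - l) ω b)
        = (η (t - k) ω a * η (t - k) ω a) * (η (t - l) ω b * η (t - l) ω b) := fun ω => by ring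
    simp_rw [h1]
    rw [(hind t).integral_fun_mul_eq_mul_integral (hsq _ _).aestronglyMeasurable
      (hsq _ _).aestronglyMeasurable, hconst (t - k) 0, hconst (t - l) 0]
  · intro t s hts
    -- One of the four time indices differs from the other three, so its mean-zero factor splits
    -- off: `t - k` in general, and `t - l` when `t - k = s - l`, since `t - l = s - k` would then
    -- force `k = l`.
    by_cases hcase : t - k = s - l
    · have hT : t - l ∉ ({t - k, s - k, s - l} : Finset ℤ) := by
        simp only [Finset.mem_insert, Finset.mem_singleton]
        omega
      have := h.integral_mul_eq_zero hT b
        (g := fun v => v ⟨t - k, by simp⟩ a * (v ⟨s - k, by simp⟩ a * v ⟨s - l, by simp⟩ b))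
        (by fun_prop)
      rw [← this]
      congr 1
      funext ω
      ring
    · have hT : t - k ∉ ({t - l, s - k, s - l} : Finset ℤ) := by
        simp only [Finset.mem_insert, Finset.mem_singleton]
        omega
      have := h.integral_mul_eq_zero hT a
        (g := fun v => v ⟨t - l, by simp⟩ b * (v ⟨s - k, by simp⟩ a * v ⟨s - l, by simp⟩ b))
        (by fun_prop)
      rw [← this]
      congr 1
      funext ω
      ring

/-- The finite moving average `∑_{k ∈ F} w_k' η_{t-k}`. -/
def movingAverage (η : ℤ → Ω → Fin d → ℝ) (w : ℤ → Fin d → ℝ) (F : Finset ℤ) (t : ℤ) (ω : Ω) : ℝ :=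
  ∑ k ∈ F, w k ⬝ᵥ η (t - k) ω

theorem IsNoise.memLp_movingAverage (h : IsNoise μ η) (w : ℤ → Fin d → ℝ) (F : Finset ℤ) (t : ℤ) :
    MemLp (movingAverage η w F t) 2 μ := by
  unfold movingAverage dotProduct
  exact memLp_finsetSum _ fun k _ => memLp_finsetSum _ fun a _ => (h.memLp (t - k) a).const_mul _

theorem IsNoise.avgTendsto_movingAverage_mul (h : IsNoise μ η) [IsProbabilityMeasure μ]
    (w w' : ℤ → Fin d → ℝ) (F : Finset ℤ) :
    ∃ c, AvgTendsto μ (fun t ω => movingAverage η w F t ω * movingAverage η w' F t ω) c := by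
  have key : ∃ c, AvgTendsto μ (fun t ω => ∑ k ∈ F, ∑ l ∈ F, ∑ a, ∑ b,
      w k a * w' l b * (η (t - k) ω a * η (t - l) ω b)) c := by
    refine AvgTendsto.sum _ fun k => AvgTendsto.sum _ fun l => AvgTendsto.sum _ fun a =>
      AvgTendsto.sum _ fun b => ?_
    have : ∃ c, AvgTendsto μ (fun t ω => η (t - k) ω a * η (t - l) ω b) c := by
      by_cases hkl : k = l
      · subst hkl
        exact h.avgTendsto_same k a b
      · exact ⟨0, h.avgTendsto_ne hkl a b⟩
    obtain ⟨c, hc⟩ := this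
    exact ⟨_, hc.const_mul _⟩
  convert key using 5 with c t ω
  simp only [movingAverage, dotProduct, Finset.sum_mul_sum]
  refine Finset.sum_congr rfl fun k _ => Finset.sum_congr rfl fun l _ =>
    Finset.sum_congr rfl fun a _ => Finset.sum_congr rfl fun b _ => ?_
  ring

/-- Strict stationarity: the family `k ↦ η (t - k)` is i.i.d., so its joint law does not depend on
`t`. -/
theorem IsNoise.eLpNorm_movingAverage_sub (h : IsNoise μ η) (w : ℤ → Fin d → ℝ)
    (F F' : Finset ℤ) (t : ℤ) :
    eLpNorm (fun ω => movingAverage η w F t ω - movingAverage η w F' t ω) 2 μ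
      = eLpNorm (fun ω => movingAverage η w F 0 ω - movingAverage η w F' 0 ω) 2 μ := by
  have hinj : ∀ s : ℤ, iIndepFun (fun k ω => η (s - k) ω) μ := fun s =>
    h.indep.precomp (g := fun k => s - k) (sub_right_injective)
  have hid := IdentDistrib.pi (fun k => (h.ident (t - k)).trans (h.ident (0 - k)).symm)
    (hinj t) (hinj 0)
  have hm : Measurable fun v : ℤ → Fin d → ℝ =>
      ∑ k ∈ F, w k ⬝ᵥ v k - ∑ k ∈ F', w k ⬝ᵥ v k := by
    unfold dotProduct
    fun_prop
  exact (hid.comp hm).eLpNorm_eq 2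

/-- The univariate linear process with weights `w`, as a mean square limit. -/
structure IsFilter (μ : Measure Ω) (η : ℤ → Ω → Fin d → ℝ) (w : ℤ → Fin d → ℝ)
    (u : ℤ → Ω → ℝ) : Prop where
  memLp : ∀ t, MemLp (u t) 2 μ
  tendsto : ∀ t, Tendsto (fun N : ℕ => eLpNorm (fun ω => u t ω -
    movingAverage η w (Finset.Icc (-(N : ℤ)) N) t ω) 2 μ) atTop (𝓝 0)

/-- Insert a long truncation `G`: the distance between two finite moving averages is the same at
times `t` and `0`, and the distance from `u` to `G` tends to zero at both. Approximation at time 0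
is thus uniform in time. -/
theorem IsFilter.eLpNorm_sub_le (h : IsNoise μ η) {w : ℤ → Fin d → ℝ} {u : ℤ → Ω → ℝ}
    (hu : IsFilter μ η w u) (F : Finset ℤ) (t : ℤ) :
    eLpNorm (fun ω => u t ω - movingAverage η w F t ω) 2 μ
      ≤ eLpNorm (fun ω => u 0 ω - movingAverage η w F 0 ω) 2 μ := by
  have hlim := ((hu.tendsto t).add (hu.tendsto 0)).add_const
    (eLpNorm (fun ω => u 0 ω - movingAverage η w F 0 ω) 2 μ)
  rw [add_zero, zero_add] at hlim
  refine ge_of_tendsto' hlim fun N => ?_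
  set G := Finset.Icc (-(N : ℤ)) N
  have hd : ∀ s, AEStronglyMeasurable (fun ω => u s ω - movingAverage η w G s ω) μ := fun s =>
    ((hu.memLp s).sub (h.memLp_movingAverage w G s)).aestronglyMeasurable
  have hd' : ∀ s, AEStronglyMeasurable (fun ω => u s ω - movingAverage η w F s ω) μ := fun s =>
    ((hu.memLp s).sub (h.memLp_movingAverage w F s)).aestronglyMeasurable
  have hd'' : ∀ s, AEStronglyMeasurable
      (fun ω => movingAverage η w G s ω - movingAverage η w F s ω) μ := fun s =>
    ((h.memLp_movingAverage w G s).sub (h.memLp_movingAverage w F s)).aestronglyMeasurable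
  have h1 : (fun ω => u t ω - movingAverage η w F t ω)
      = (fun ω => u t ω - movingAverage η w G t ω)
        + fun ω => movingAverage η w G t ω - movingAverage η w F t ω := by
    funext ω; simp
  have h2 : (fun ω => movingAverage η w G 0 ω - movingAverage η w F 0 ω)
      = (fun ω => u 0 ω - movingAverage η w F 0 ω)
        - fun ω => u 0 ω - movingAverage η w G 0 ω := by
    funext ω; simp
  rw [h1]
  refine (eLpNorm_add_le (hd t) (hd'' t) one_le_two).trans ?_
  rw [h.eLpNorm_movingAverage_sub, h2, add_assoc]
  refine add_le_add le_rfl ((MeasureTheory.eLpNorm_sub_le (hd' 0) (hd 0) one_le_two).trans ?_)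
  rw [add_comm]

/-- Cauchy–Schwarz applied to `u (v - v') + (u - u') v'`, with `v'` bounded through `v` so that only
`u`, `v` and the two errors appear. -/
theorem eLpNorm_mul_sub_mul_le {u v u' v' : Ω → ℝ} (hu : MemLp u 2 μ) (hv : MemLp v 2 μ)
    (hu' : MemLp u' 2 μ) (hv' : MemLp v' 2 μ) :
    eLpNorm (fun ω => u ω * v ω - u' ω * v' ω) 1 μ
      ≤ eLpNorm u 2 μ * eLpNorm (fun ω => v ω - v' ω) 2 μ
        + eLpNorm (fun ω => u ω - u' ω) 2 μ
          * (eLpNorm v 2 μ + eLpNorm (fun ω => v ω - v' ω) 2 μ) := by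
  have h1 : (fun ω => u ω * v ω - u' ω * v' ω)
      = (u • fun ω => v ω - v' ω) + ((fun ω => u ω - u' ω) • v') := by
    funext ω
    simp only [Pi.add_apply, smul_eq_mul, Pi.mul_apply]
    ring
  have mu := hu.aestronglyMeasurable
  have mv' := hv'.aestronglyMeasurable
  have mdu : AEStronglyMeasurable (fun ω => u ω - u' ω) μ := (hu.sub hu').aestronglyMeasurable
  have mdv : AEStronglyMeasurable (fun ω => v ω - v' ω) μ := (hv.sub hv').aestronglyMeasurable
  have h2 : eLpNorm v' 2 μ ≤ eLpNorm v 2 μ + eLpNorm (fun ω => v ω - v' ω) 2 μ := by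
    have : v' = v - fun ω => v ω - v' ω := by funext ω; simp
    calc eLpNorm v' 2 μ = eLpNorm (v - fun ω => v ω - v' ω) 2 μ := by rw [← this]
      _ ≤ _ := eLpNorm_sub_le hv.aestronglyMeasurable mdv one_le_two
  rw [h1]
  refine (eLpNorm_add_le (mu.smul mdv) (mdu.smul mv') le_rfl).trans ?_
  refine add_le_add (eLpNorm_smul_le_mul_eLpNorm mdv mu) ?_
  refine (eLpNorm_smul_le_mul_eLpNorm (p := 2) (q := 2) mv' mdu).trans ?_
  gcongr

theorem IsFilter.avgTendsto_mul [IsProbabilityMeasure μ] (h : IsNoise μ η)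
    {w w' : ℤ → Fin d → ℝ} {u v : ℤ → Ω → ℝ} (hu : IsFilter μ η w u) (hv : IsFilter μ η w' v)
    {c : ℝ} (hc : ∀ t, ∫ ω, u t ω * v t ω ∂μ = c) : AvgTendsto μ (fun t ω => u t ω * v t ω) c := by
  refine AvgTendsto.of_approx (fun t => memLp_one_iff_integrable.2
    ((hu.memLp t).integrable_mul (hv.memLp t))) hc fun δ hδ => ?_
  -- Truncation to the empty set bounds the norms uniformly in time.
  have hKu : ∀ t, eLpNorm (u t) 2 μ ≤ eLpNorm (u 0) 2 μ := fun t => by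
    simpa [movingAverage] using hu.eLpNorm_sub_le h ∅ t
  have hKv : ∀ t, eLpNorm (v t) 2 μ ≤ eLpNorm (v 0) 2 μ := fun t => by
    simpa [movingAverage] using hv.eLpNorm_sub_le h ∅ t
  have hlim : Tendsto (fun N : ℕ => eLpNorm (u 0) 2 μ * eLpNorm (fun ω => v 0 ω -
        movingAverage η w' (Finset.Icc (-(N : ℤ)) N) 0 ω) 2 μ
      + eLpNorm (fun ω => u 0 ω - movingAverage η w (Finset.Icc (-(N : ℤ)) N) 0 ω) 2 μ
        * (eLpNorm (v 0) 2 μ + eLpNorm (fun ω => v 0 ω -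
          movingAverage η w' (Finset.Icc (-(N : ℤ)) N) 0 ω) 2 μ)) atTop (𝓝 0) := by
    have h1 := ENNReal.Tendsto.const_mul (a := eLpNorm (u 0) 2 μ) (hv.tendsto 0)
      (Or.inr (hu.memLp 0).eLpNorm_ne_top)
    have h2 := ENNReal.Tendsto.mul (hu.tendsto 0)
      (Or.inr (by simpa using (hv.memLp 0).eLpNorm_ne_top))
      ((hv.tendsto 0).const_add (eLpNorm (v 0) 2 μ)) (Or.inr ENNReal.zero_ne_top)
    simpa using h1.add h2
  obtain ⟨N, hN⟩ := (hlim.eventually (ge_mem_nhds hδ)).exists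
  obtain ⟨e, he⟩ := h.avgTendsto_movingAverage_mul w w' (Finset.Icc (-(N : ℤ)) N)
  refine ⟨_, e, he, fun t => ?_⟩
  refine (eLpNorm_mul_sub_mul_le (hu.memLp t) (hv.memLp t) (h.memLp_movingAverage _ _ _)
    (h.memLp_movingAverage _ _ _)).trans (le_trans ?_ hN)
  have h1 := hu.eLpNorm_sub_le h (Finset.Icc (-(N : ℤ)) N) t
  have h2 := hv.eLpNorm_sub_le h (Finset.Icc (-(N : ℤ)) N) t
  have h3 := hKu t
  have h4 := hKv t
  gcongr

theorem IsLinearProcess.avgTendsto_mul [IsProbabilityMeasure μ] {ι : Type*} {z : ℤ → Ω → ι → ℝ}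
    (hz : IsLinearProcess μ z) {i j : ι} {c : ℝ} (hc : ∀ t, ∫ ω, z t ω i * z t ω j ∂μ = c) :
    AvgTendsto μ (fun t ω => z t ω i * z t ω j) c := by
  obtain ⟨hL, d, η, A, hind, hid, hmom, -, hlim⟩ := hz
  have h : IsNoise μ η := ⟨hind, hid, fun t a => (hmom t a).1, fun t a => (hmom t a).2⟩
  have hf : ∀ i, IsFilter μ η (fun k => A k i) (fun t ω => z t ω i) := fun i =>
    ⟨fun t => hL t i, fun t => hlim t i⟩
  exact (hf i).avgTendsto_mul h (hf j) hc

end LinearProcess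

end RegGSA

namespace RegGSA

/-! ### Submodel coefficients and residual variances as functions of second moments -/

section Submodels

variable {p : ℕ}

theorem selMatrix_mulVec (γ : Spec p) (v : Fin p → ℝ) (j : Fin p) :
    (selMatrix γ *ᵥ v) j = if γ j then v j else 0 := by
  rw [selMatrix, Matrix.mulVec_diagonal]
  split_ifs <;> simp

theorem selMatrix_mul_self (γ : Spec p) : selMatrix γ * selMatrix γ = selMatrix γ := by
  rw [selMatrix, Matrix.diagonal_mul_diagonal]
  congr 1
  funext j
  split_ifs <;> simp

theorem selMatrix_transpose (γ : Spec p) : (selMatrix γ)ᵀ = selMatrix γ :=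
  Matrix.diagonal_transpose _

/-- `D_γ G D_γ + (1 - D_γ)`, which is invertible when the submatrix of `G` selected by `γ` is. -/
noncomputable def compression (G : Matrix (Fin p) (Fin p) ℝ) (γ : Spec p) :
    Matrix (Fin p) (Fin p) ℝ :=
  selMatrix γ * G * selMatrix γ + (1 - selMatrix γ)

theorem compression_mulVec (G : Matrix (Fin p) (Fin p) ℝ) (γ : Spec p) (v : Fin p → ℝ)
    (j : Fin p) :
    (compression G γ *ᵥ v) j = if γ j then (G *ᵥ (selMatrix γ *ᵥ v)) j else v j := by
  rw [compression, Matrix.add_mulVec, Matrix.sub_mulVec, Matrix.one_mulVec, Pi.add_apply,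
    Pi.sub_apply, Matrix.mul_assoc, ← Matrix.mulVec_mulVec, ← Matrix.mulVec_mulVec,
    selMatrix_mulVec, selMatrix_mulVec]
  split_ifs <;> simp

theorem compression_mul_selMatrix (G : Matrix (Fin p) (Fin p) ℝ) (γ : Spec p) :
    compression G γ * selMatrix γ = selMatrix γ * G * selMatrix γ := by
  rw [compression, Matrix.add_mul, Matrix.sub_mul, Matrix.one_mul, selMatrix_mul_self, sub_self,
    add_zero, Matrix.mul_assoc _ (selMatrix γ), selMatrix_mul_self]

theorem selMatrix_mul_compression (G : Matrix (Fin p) (Fin p) ℝ) (γ : Spec p) :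
    selMatrix γ * compression G γ = selMatrix γ * G * selMatrix γ := by
  rw [compression, Matrix.mul_add, Matrix.mul_sub, Matrix.mul_one, selMatrix_mul_self, sub_self,
    add_zero, ← Matrix.mul_assoc, ← Matrix.mul_assoc, selMatrix_mul_self]

/-- A kernel vector `v` vanishes outside `γ`, while `S v` vanishes on `γ`; hence `v' S v = 0`,
against positive definiteness. -/
theorem det_compression_ne_zero {S : Matrix (Fin p) (Fin p) ℝ} (hS : S.PosDef) (γ : Spec p) :
    (compression S γ).det ≠ 0 := by
  intro h
  obtain ⟨v, hv, hMv⟩ := Matrix.exists_mulVec_eq_zero_iff.2 h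
  have hDv : selMatrix γ *ᵥ v = v := by
    funext j
    have := congrFun hMv j
    rw [compression_mulVec] at this
    rw [selMatrix_mulVec]
    split_ifs at this ⊢ with hj
    · rfl
    · exact this.symm
  have hpos := hS.dotProduct_mulVec_pos hv
  refine hpos.ne' (Finset.sum_eq_zero fun j _ => ?_)
  have h1 := congrFun hMv j
  have h2 := congrFun hDv j
  rw [compression_mulVec, hDv] at h1
  rw [selMatrix_mulVec] at h2
  split_ifs at h1 h2 with hj
  · rw [h1]; simp
  · simp [← h2]

/-- `D_γ` commutes with the compression, both products being `D_γ G D_γ`, hence also with its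
inverse. Both products of `D_γ G D_γ` with the candidate are then the symmetric projection `D_γ`,
which gives the Penrose equations. -/
theorem pinv_selMatrix {G : Matrix (Fin p) (Fin p) ℝ} {γ : Spec p}
    (h : (compression G γ).det ≠ 0) :
    pinv (selMatrix γ * G * selMatrix γ) = (compression G γ)⁻¹ * selMatrix γ := by
  have hu : IsUnit (compression G γ).det := isUnit_iff_ne_zero.2 h
  have hcomm : (compression G γ)⁻¹ * selMatrix γ = selMatrix γ * (compression G γ)⁻¹ := by
    calc (compression G γ)⁻¹ * selMatrix γ
        = (compression G γ)⁻¹ * (selMatrix γ * compression G γ) * (compression G γ)⁻¹ := by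
          rw [Matrix.mul_assoc, Matrix.mul_assoc, Matrix.mul_nonsing_inv _ hu, Matrix.mul_one]
      _ = (compression G γ)⁻¹ * (compression G γ * selMatrix γ) * (compression G γ)⁻¹ := by
          rw [selMatrix_mul_compression, compression_mul_selMatrix]
      _ = selMatrix γ * (compression G γ)⁻¹ := by
          rw [← Matrix.mul_assoc _ (compression G γ), Matrix.nonsing_inv_mul _ hu, Matrix.one_mul]
  have hAB : selMatrix γ * G * selMatrix γ * ((compression G γ)⁻¹ * selMatrix γ)
      = selMatrix γ := by
    rw [← selMatrix_mul_compression, Matrix.mul_assoc, ← Matrix.mul_assoc (compression G γ),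
      Matrix.mul_nonsing_inv _ hu, Matrix.one_mul, selMatrix_mul_self]
  have hBA : (compression G γ)⁻¹ * selMatrix γ * (selMatrix γ * G * selMatrix γ)
      = selMatrix γ := by
    rw [hcomm, ← compression_mul_selMatrix, Matrix.mul_assoc,
      ← Matrix.mul_assoc _ (compression G γ), Matrix.nonsing_inv_mul _ hu, Matrix.one_mul,
      selMatrix_mul_self]
  refine (pinv_spec _).unique ⟨?_, ?_, ?_, ?_⟩
  · rw [hAB, ← Matrix.mul_assoc, ← Matrix.mul_assoc, selMatrix_mul_self]
  · rw [hBA, hcomm, ← Matrix.mul_assoc, selMatrix_mul_self]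
  · rw [hAB, selMatrix_transpose]
  · rw [hBA, selMatrix_transpose]

theorem pinv_smul {m n : Type*} [Fintype m] [Fintype n] (A : Matrix m n ℝ) {c : ℝ} (hc : c ≠ 0) :
    pinv (c • A) = c⁻¹ • pinv A := by
  have h := pinv_spec A
  refine (pinv_spec _).unique ⟨?_, ?_, ?_, ?_⟩
  · simp [h.mul_mul_left, smul_smul, hc]
  · simp [h.mul_mul_right, smul_smul, hc]
  · simp [h.symm_left, smul_smul, hc]
  · simp [h.symm_right, smul_smul, hc]

/-- The coefficients of the submodel `γ` computed from the second moments `G` of the regressors and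
their cross moments `r` with the response. -/
noncomputable def submodelCoef (G : Matrix (Fin p) (Fin p) ℝ) (r : Fin p → ℝ) (γ : Spec p) :
    Fin p → ℝ :=
  pinv (selMatrix γ * G * selMatrix γ) *ᵥ (selMatrix γ *ᵥ r)

theorem submodelCoef_eq {G : Matrix (Fin p) (Fin p) ℝ} {γ : Spec p}
    (h : (compression G γ).det ≠ 0) (r : Fin p → ℝ) :
    submodelCoef G r γ = (compression G γ)⁻¹ *ᵥ (selMatrix γ *ᵥ r) := by
  rw [submodelCoef, pinv_selMatrix h, ← Matrix.mulVec_mulVec, Matrix.mulVec_mulVec _ (selMatrix γ),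
    selMatrix_mul_self]

/-- These are the normal equations of the submodel, which in compressed form are a nonsingular
linear system for `b`. -/
theorem submodelCoef_unique {G : Matrix (Fin p) (Fin p) ℝ} {γ : Spec p}
    (h : (compression G γ).det ≠ 0) {r b : Fin p → ℝ} (hb : ∀ j, γ j = false → b j = 0)
    (hG : ∀ j, γ j = true → (G *ᵥ b) j = r j) : submodelCoef G r γ = b := by
  have hDb : selMatrix γ *ᵥ b = b := by
    funext j
    rw [selMatrix_mulVec]
    split_ifs with hj
    · rfl
    · exact (hb j (by simpa using hj)).symm
  have hMb : compression G γ *ᵥ b = selMatrix γ *ᵥ r := by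
    funext j
    rw [compression_mulVec, selMatrix_mulVec, hDb]
    split_ifs with hj
    · exact hG j hj
    · exact hb j (by simpa using hj)
  rw [submodelCoef_eq h, ← hMb, Matrix.mulVec_mulVec,
    Matrix.nonsing_inv_mul _ (isUnit_iff_ne_zero.2 h), Matrix.one_mulVec]

theorem submodelCoef_spec {G : Matrix (Fin p) (Fin p) ℝ} {γ : Spec p}
    (h : (compression G γ).det ≠ 0) (r : Fin p → ℝ) :
    (∀ j, γ j = false → submodelCoef G r γ j = 0) ∧
      ∀ j, γ j = true → (G *ᵥ submodelCoef G r γ) j = r j := by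
  have hM : compression G γ *ᵥ submodelCoef G r γ = selMatrix γ *ᵥ r := by
    rw [submodelCoef_eq h, Matrix.mulVec_mulVec,
      Matrix.mul_nonsing_inv _ (isUnit_iff_ne_zero.2 h), Matrix.one_mulVec]
  have h0 : ∀ j, γ j = false → submodelCoef G r γ j = 0 := by
    intro j hj
    have := congrFun hM j
    rw [compression_mulVec, selMatrix_mulVec] at this
    simpa [hj] using this
  refine ⟨h0, fun j hj => ?_⟩
  have hD : selMatrix γ *ᵥ submodelCoef G r γ = submodelCoef G r γ := by
    funext k
    rw [selMatrix_mulVec]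
    split_ifs with hk
    · rfl
    · exact (h0 k (by simpa using hk)).symm
  have := congrFun hM j
  rw [compression_mulVec, selMatrix_mulVec, hD] at this
  simpa [hj] using this

/-- The second moment of the residual of the submodel `γ`, computed from the matrix `V` of the
second moments of the regressors and the error. -/
noncomputable def momentResidVar (β₀ : Fin p → ℝ) (V : Matrix (Fin p ⊕ Unit) (Fin p ⊕ Unit) ℝ)
    (γ : Spec p) : ℝ :=
  Sum.elim (β₀ - submodelCoef V.toBlocks₁₁
      (V.toBlocks₁₁ *ᵥ β₀ + fun j => V (Sum.inl j) (Sum.inr ())) γ) (fun _ => 1) ⬝ᵥ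
    V *ᵥ Sum.elim (β₀ - submodelCoef V.toBlocks₁₁
      (V.toBlocks₁₁ *ᵥ β₀ + fun j => V (Sum.inl j) (Sum.inr ())) γ) (fun _ => 1)

/-- The residual is `Z θ` with `θ = (β₀ - β̂_γ, 1)`, so its mean square is a quadratic form in `n⁻¹
Z'Z`; the factors `n⁻¹` cancel in the coefficients. -/
theorem residVar_eq_momentResidVar {n : ℕ} (hn : n ≠ 0) (β₀ : Fin p → ℝ)
    (X : Matrix (Fin n) (Fin p) ℝ) (e : Fin n → ℝ) (Z : Matrix (Fin n) (Fin p ⊕ Unit) ℝ)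
    (hX : ∀ t j, Z t (Sum.inl j) = X t j) (he : ∀ t, Z t (Sum.inr ()) = e t) (γ : Spec p) :
    residVar X (X *ᵥ β₀ + e) γ = momentResidVar β₀ ((n : ℝ)⁻¹ • (Zᵀ * Z)) γ := by
  have hn' : (n : ℝ) ≠ 0 := by exact_mod_cast hn
  set V := (n : ℝ)⁻¹ • (Zᵀ * Z) with hV
  have hG : V.toBlocks₁₁ = (n : ℝ)⁻¹ • (Xᵀ * X) := by
    ext j k
    simp [hV, Matrix.toBlocks₁₁, Matrix.mul_apply, hX]
  have hr : V.toBlocks₁₁ *ᵥ β₀ + (fun j => V (Sum.inl j) (Sum.inr ()))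
      = (n : ℝ)⁻¹ • (Xᵀ *ᵥ (X *ᵥ β₀ + e)) := by
    rw [hG, Matrix.mulVec_add, smul_add, Matrix.smul_mulVec, Matrix.mulVec_mulVec]
    congr 1
    funext j
    simp [hV, Matrix.mul_apply, hX, he, Matrix.mulVec, dotProduct]
  have hcoef : submodelCoef V.toBlocks₁₁
      (V.toBlocks₁₁ *ᵥ β₀ + fun j => V (Sum.inl j) (Sum.inr ())) γ
      = ols X (X *ᵥ β₀ + e) γ := by
    rw [hr, hG, submodelCoef, ols, Matrix.mul_smul, Matrix.smul_mul, pinv_smul _ (inv_ne_zero hn'),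
      inv_inv, Matrix.mulVec_smul, Matrix.mulVec_smul, Matrix.smul_mulVec, smul_smul,
      inv_mul_cancel₀ hn', one_smul, Matrix.mulVec_mulVec, Matrix.mulVec_mulVec,
      ← Matrix.mul_assoc (selMatrix γ) Xᵀ X]
  rw [momentResidVar, hcoef, residVar]
  have hres : resid X (X *ᵥ β₀ + e) γ
      = Z *ᵥ Sum.elim (β₀ - ols X (X *ᵥ β₀ + e) γ) (fun _ => 1) := by
    rw [resid]
    funext t
    simp only [Pi.sub_apply, Pi.add_apply, Matrix.mulVec, dotProduct, Fintype.sum_sum_type,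
      Sum.elim_inl, Sum.elim_inr, hX, he, mul_sub, Finset.sum_sub_distrib]
    simp only [mul_one, Finset.univ_unique, Finset.sum_const, Finset.card_singleton, one_smul]
    ring
  rw [hres, hV, Matrix.smul_mulVec, dotProduct_smul, ← Matrix.mulVec_mulVec,
    Matrix.dotProduct_mulVec _ Zᵀ, Matrix.vecMul_transpose, smul_eq_mul]

theorem momentResidVar_fromBlocks (β₀ : Fin p → ℝ) (S : Matrix (Fin p) (Fin p) ℝ) (v : ℝ)
    (γ : Spec p) :
    momentResidVar β₀ (Matrix.fromBlocks S 0 0 (Matrix.of fun _ _ => v)) γ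
      = (β₀ - submodelCoef S (S *ᵥ β₀) γ) ⬝ᵥ S *ᵥ (β₀ - submodelCoef S (S *ᵥ β₀) γ) + v := by
  have h0 : (S *ᵥ β₀ + fun j => (Matrix.fromBlocks S 0 0 (Matrix.of fun _ _ => v) :
      Matrix (Fin p ⊕ Unit) (Fin p ⊕ Unit) ℝ) (Sum.inl j) (Sum.inr ())) = S *ᵥ β₀ := by
    funext j; simp
  rw [momentResidVar, Matrix.toBlocks_fromBlocks₁₁, h0, Matrix.fromBlocks_mulVec]
  simp [dotProduct, Matrix.mulVec, Fintype.sum_sum_type, Function.comp_def]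

/-- Nonsingularity of the compression is an open condition, so near `t` the pseudoinverse is given
by a genuine inverse. -/
theorem continuousAt_submodelCoef {T : Type*} [TopologicalSpace T]
    {G : T → Matrix (Fin p) (Fin p) ℝ} {r : T → Fin p → ℝ} {t : T} (hG : Continuous G)
    (hr : Continuous r) {γ : Spec p} (h : (compression (G t) γ).det ≠ 0) :
    ContinuousAt (fun s => submodelCoef (G s) (r s) γ) t := by
  have hM : Continuous fun s => compression (G s) γ := by
    unfold compression
    fun_prop
  have hdet : ∀ᶠ s in 𝓝 t, (compression (G s) γ).det ≠ 0 :=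
    hM.matrix_det.continuousAt.eventually_ne h
  have hinv : ContinuousAt (fun s => (compression (G s) γ)⁻¹) t := by
    refine ContinuousAt.comp (g := Inv.inv) (continuousAt_matrix_inv _ ?_) hM.continuousAt
    rw [Ring.inverse_eq_inv']
    exact continuousAt_inv₀ h
  have hprod : ContinuousAt
      (fun s => (compression (G s) γ)⁻¹ *ᵥ (selMatrix γ *ᵥ r s)) t := by
    have hc : Continuous fun q : Matrix (Fin p) (Fin p) ℝ × (Fin p → ℝ) => q.1 *ᵥ q.2 :=
      continuous_fst.matrix_mulVec continuous_snd
    have hr' : Continuous fun s => selMatrix γ *ᵥ r s := continuous_const.matrix_mulVec hr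
    exact hc.continuousAt.comp (f := fun s => ((compression (G s) γ)⁻¹, selMatrix γ *ᵥ r s))
      (hinv.prodMk hr'.continuousAt)
  refine hprod.congr ?_
  filter_upwards [hdet] with s hs
  rw [submodelCoef_eq hs]

theorem continuousAt_momentResidVar (β₀ : Fin p → ℝ)
    {V : Matrix (Fin p ⊕ Unit) (Fin p ⊕ Unit) ℝ} {γ : Spec p}
    (h : (compression V.toBlocks₁₁ γ).det ≠ 0) :
    ContinuousAt (fun W => momentResidVar β₀ W γ) V := by
  have hG : Continuous fun W : Matrix (Fin p ⊕ Unit) (Fin p ⊕ Unit) ℝ => W.toBlocks₁₁ :=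
    continuous_matrix fun j k => continuous_id.matrix_elem _ _
  have hr : Continuous fun W : Matrix (Fin p ⊕ Unit) (Fin p ⊕ Unit) ℝ =>
      W.toBlocks₁₁ *ᵥ β₀ + fun j => W (Sum.inl j) (Sum.inr ()) :=
    (hG.matrix_mulVec continuous_const).add
      (continuous_pi fun j => continuous_id.matrix_elem _ _)
  have hb := continuousAt_submodelCoef (γ := γ) hG hr h
  have hc : Continuous fun q : Matrix (Fin p ⊕ Unit) (Fin p ⊕ Unit) ℝ × (Fin p → ℝ) =>
      (Sum.elim (β₀ - q.2) (fun _ => 1) : Fin p ⊕ Unit → ℝ) ⬝ᵥ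
        q.1 *ᵥ Sum.elim (β₀ - q.2) (fun _ => 1) := by
    have hθ : Continuous fun q : Matrix (Fin p ⊕ Unit) (Fin p ⊕ Unit) ℝ × (Fin p → ℝ) =>
        (Sum.elim (β₀ - q.2) (fun _ => 1) : Fin p ⊕ Unit → ℝ) := by
      refine continuous_pi fun a => ?_
      cases a with
      | inl j => simp only [Sum.elim_inl, Pi.sub_apply]; fun_prop
      | inr j => simp only [Sum.elim_inr]; fun_prop
    exact hθ.dotProduct (continuous_fst.matrix_mulVec hθ)
  exact ContinuousAt.comp (f := fun W : Matrix (Fin p ⊕ Unit) (Fin p ⊕ Unit) ℝ =>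
    (W, submodelCoef W.toBlocks₁₁
      (W.toBlocks₁₁ *ᵥ β₀ + fun j => W (Sum.inl j) (Sum.inr ())) γ))
    hc.continuousAt (continuousAt_id.prodMk hb)

/-- Orthogonality gives irrelevant regressors population coefficient zero: the coefficients of the
true part of `γ` already solve the normal equations of `γ`. -/
theorem submodelCoef_congr {S : Matrix (Fin p) (Fin p) ℝ} (hS : S.PosDef) {β₀ : Fin p → ℝ}
    (horth : ∀ j l : Fin p, β₀ j ≠ 0 → β₀ l = 0 → S l j = 0) {γ γ' : Spec p}
    (h : ∀ j, β₀ j ≠ 0 → γ j = γ' j) :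
    submodelCoef S (S *ᵥ β₀) γ = submodelCoef S (S *ᵥ β₀) γ' := by
  have key : ∀ γ : Spec p, submodelCoef S (S *ᵥ β₀) γ
      = submodelCoef S (S *ᵥ β₀) fun j => γ j && decide (β₀ j ≠ 0) := by
    intro γ
    obtain ⟨h0, h1⟩ := submodelCoef_spec
      (det_compression_ne_zero hS fun j => γ j && decide (β₀ j ≠ 0)) (S *ᵥ β₀)
    refine submodelCoef_unique (det_compression_ne_zero hS γ)
      (fun j hj => h0 j (by simp [hj])) fun l hl => ?_
    -- For irrelevant `l` the equation holds term by term: either `S l j = 0`, or both `β₀ j` and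
    -- the coefficient at `j` are zero.
    by_cases hβ : β₀ l = 0
    · simp only [Matrix.mulVec, dotProduct]
      refine Finset.sum_congr rfl fun j _ => ?_
      by_cases hj : β₀ j = 0
      · rw [h0 j (by simp [hj]), hj]
      · rw [horth j l hj hβ, zero_mul, zero_mul]
    · exact h1 l (by simp [hl, hβ])
  rw [key γ, key γ']
  congr 1
  funext j
  by_cases hj : β₀ j = 0
  · simp [hj]
  · rw [h j hj]

end Submodels

/-! ### Total variance under the uniform distribution -/

section TotalVar

theorem integral_uniformOn {α : Type*} [Finite α] [MeasurableSpace α] [MeasurableSingletonClass α]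
    (s : Finset α) (F : α → ℝ) :
    ∫ a, F a ∂(uniformOn (s : Set α)) = (s.card : ℝ)⁻¹ * ∑ a ∈ s, F a := by
  rw [uniformOn, ProbabilityTheory.cond, integral_smul_measure,
    setIntegral_finset s IntegrableOn.finset]
  simp [Measure.count_apply_finset, Measure.real]

/-- Fixing the other coordinates leaves two equally likely points, and the variance is then the
square of half the difference. -/
theorem totalVar_eq {p : ℕ} (q : Spec p → ℝ) (i : Fin p) :
    totalVar q i = (Fintype.card (Spec p) : ℝ)⁻¹ *
      ∑ γ, ((q (Function.update γ i true) - q (Function.update γ i false)) / 2) ^ 2 := by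
  have hvar : ∀ γ : Spec p, Var[q; (unifSpec p)[|{γ' : Spec p | ∀ j, j ≠ i → γ' j = γ j}]]
      = ((q (Function.update γ i true) - q (Function.update γ i false)) / 2) ^ 2 := by
    intro γ
    have hset : {γ' : Spec p | ∀ j, j ≠ i → γ' j = γ j}
        = (({Function.update γ i true, Function.update γ i false} : Finset (Spec p)) :
          Set (Spec p)) := by
      ext γ'
      simp only [Set.mem_ofPred_eq, Finset.coe_insert, Finset.coe_singleton, Set.mem_insert_iff,
        Set.mem_singleton_iff, Function.eq_update_iff]
      cases γ' i <;> simp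
    have hne : Function.update γ i true ≠ Function.update γ i false := fun h => by
      simpa using congrFun h i
    have hcond : (unifSpec p)[|{γ' : Spec p | ∀ j, j ≠ i → γ' j = γ j}]
        = uniformOn (({Function.update γ i true, Function.update γ i false} : Finset (Spec p)) :
          Set (Spec p)) := by
      rw [hset, unifSpec, uniformOn, cond_cond_eq_cond_inter' MeasurableSet.univ
        (Finset.measurableSet _) (by simp), Set.univ_inter, uniformOn]
    rw [hcond, variance_eq_integral (Measurable.of_discrete).aemeasurable, integral_uniformOn,
      integral_uniformOn, Finset.sum_pair hne, Finset.sum_pair hne, Finset.card_pair hne]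
    push_cast
    ring
  simp_rw [totalVar, hvar, unifSpec]
  rw [← Finset.coe_univ, integral_uniformOn, Finset.card_univ]

end TotalVar

end RegGSA

namespace RegGSA

/-! ### Probability limits of the criterion and of the total variance -/

section Limits

variable {Ω : Type*} [MeasurableSpace Ω] {μ : Measure Ω} {p : ℕ}

/-- The continuous mapping theorem for convergence in measure to a constant vector. -/
theorem tendstoInMeasure_of_tendsto_prod {J : Type*} [Fintype J] {W : J → ℕ → Ω → ℝ} {w : J → ℝ}
    (hW : ∀ j, TendstoInMeasure μ (W j) atTop fun _ => w j) {Φ : ℕ → (J → ℝ) → ℝ} {L : ℝ}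
    (hΦ : Tendsto (fun q : ℕ × (J → ℝ) => Φ q.1 q.2) (atTop ×ˢ 𝓝 w) (𝓝 L)) {Y : ℕ → Ω → ℝ}
    (hY : ∀ᶠ n in atTop, ∀ ω, Y n ω = Φ n fun j => W j n ω) :
    TendstoInMeasure μ Y atTop fun _ => L := by
  rw [tendstoInMeasure_iff_dist]
  intro e he
  have h1 : ∀ᶠ q : ℕ × (J → ℝ) in atTop ×ˢ 𝓝 w, dist (Φ q.1 q.2) L < e :=
    hΦ (Metric.ball_mem_nhds L he)
  obtain ⟨pa, hpa, pb, hpb, hab⟩ := eventually_prod_iff.1 h1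
  obtain ⟨δ, hδ, hball⟩ := Metric.eventually_nhds_iff.1 hpb
  have hlim : Tendsto (fun n => ∑ j, μ {ω | δ ≤ dist (W j n ω) (w j)}) atTop (𝓝 0) := by
    have := tendsto_finsetSum Finset.univ fun j _ => (tendstoInMeasure_iff_dist.1 (hW j)) δ hδ
    simpa using this
  refine tendsto_of_tendsto_of_tendsto_of_le_of_le' tendsto_const_nhds hlim
    (.of_forall fun _ => zero_le) ?_
  filter_upwards [hpa, hY] with n hn hYn
  -- In the sup metric, if every coordinate is within `δ` then so is the vector, so a union bound
  -- over coordinates suffices.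
  refine le_trans (measure_mono (t := ⋃ j, {ω | δ ≤ dist (W j n ω) (w j)}) fun ω hω => ?_)
    (measure_iUnion_fintype_le _ _)
  by_contra hcon
  simp only [Set.mem_iUnion, Set.mem_ofPred_eq, not_exists, not_le] at hcon hω
  have := hab hn (hball ((dist_pi_lt_iff hδ).2 hcon))
  rw [hYn ω] at hω
  exact absurd this (not_lt.2 hω)

/-- The probability limit of the information criterion. -/
noncomputable def limitCrit (β₀ : Fin p → ℝ) (S : Matrix (Fin p) (Fin p) ℝ) (v : ℝ)
    (γ : Spec p) : ℝ :=
  Real.log ((β₀ - submodelCoef S (S *ᵥ β₀) γ) ⬝ᵥ S *ᵥ (β₀ - submodelCoef S (S *ᵥ β₀) γ) + v)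

theorem totalVar_limitCrit_eq_zero {β₀ : Fin p → ℝ} {S : Matrix (Fin p) (Fin p) ℝ}
    (hS : S.PosDef) (horth : ∀ j l : Fin p, β₀ j ≠ 0 → β₀ l = 0 → S l j = 0) (v : ℝ) {i : Fin p}
    (hi : β₀ i = 0) : totalVar (limitCrit β₀ S v) i = 0 := by
  rw [totalVar_eq]
  have h : ∀ γ, limitCrit β₀ S v (Function.update γ i true)
      = limitCrit β₀ S v (Function.update γ i false) := by
    intro γ
    rw [limitCrit, limitCrit, submodelCoef_congr hS horth fun j hj => ?_]
    have hji : j ≠ i := fun h => hj (h ▸ hi)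
    rw [Function.update_of_ne hji, Function.update_of_ne hji]
  simp [h]

theorem totalVar_limitCrit_pos {β₀ : Fin p → ℝ} {S : Matrix (Fin p) (Fin p) ℝ}
    (hS : S.PosDef) {v : ℝ} (hv : 0 < v) {i : Fin p} (hi : β₀ i ≠ 0) :
    0 < totalVar (limitCrit β₀ S v) i := by
  rw [totalVar_eq]
  refine mul_pos (inv_pos.2 (by exact_mod_cast Fintype.card_pos)) ?_
  -- All terms are squares, so one positive term suffices: the full model against the full model
  -- without `i`. The former recovers `β₀`; the latter has bias with `i`-th coordinate `β₀ i ≠ 0`.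
  refine Finset.sum_pos' (fun γ _ => sq_nonneg _) ⟨fun _ => true, Finset.mem_univ _, ?_⟩
  have h1 : limitCrit β₀ S v (Function.update (fun _ => true) i true) = Real.log v := by
    have : submodelCoef S (S *ᵥ β₀) (Function.update (fun _ => true) i true) = β₀ := by
      refine submodelCoef_unique (det_compression_ne_zero hS _) (fun j hj => ?_) fun j _ => rfl
      simp at hj
    rw [limitCrit, this]
    simp
  have h2 : Real.log v < limitCrit β₀ S v (Function.update (fun _ => true) i false) := by
    have h0 := (submodelCoef_spec (det_compression_ne_zero hS
      (Function.update (fun _ => true) i false)) (S *ᵥ β₀)).1 i (by simp)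
    have hne : β₀ - submodelCoef S (S *ᵥ β₀) (Function.update (fun _ => true) i false) ≠ 0 := by
      intro h
      have := congrFun h i
      rw [Pi.sub_apply, h0, sub_zero] at this
      exact hi this
    have hpos := hS.dotProduct_mulVec_pos hne
    rw [star_trivial] at hpos
    exact Real.log_lt_log hv (lt_add_of_pos_left v hpos)
  have : limitCrit β₀ S v (Function.update (fun _ => true) i true)
      - limitCrit β₀ S v (Function.update (fun _ => true) i false) ≠ 0 := by
    rw [h1]
    exact (sub_neg.2 h2).ne
  positivity

theorem limitCrit_arg_pos {β₀ : Fin p → ℝ} {S : Matrix (Fin p) (Fin p) ℝ}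
    (hS : S.PosDef) {v : ℝ} (hv : 0 < v) (γ : Spec p) :
    0 < (β₀ - submodelCoef S (S *ᵥ β₀) γ) ⬝ᵥ S *ᵥ (β₀ - submodelCoef S (S *ᵥ β₀) γ) + v := by
  have := hS.posSemidef.dotProduct_mulVec_nonneg (β₀ - submodelCoef S (S *ᵥ β₀) γ)
  rw [star_trivial] at this
  exact add_pos_of_nonneg_of_pos this hv

/-- The matrix of the second moments of the regressors and the error. -/
def jointMoment (S : Matrix (Fin p) (Fin p) ℝ) (v : ℝ) : Matrix (Fin p ⊕ Unit) (Fin p ⊕ Unit) ℝ :=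
  Matrix.fromBlocks S 0 0 (Matrix.of fun _ _ => v)

theorem IsRegressionProcess.integral_joint_mul {S : Matrix (Fin p) (Fin p) ℝ} {σ : ℝ≥0}
    {x : ℤ → Ω → Fin p → ℝ} {ε : ℤ → Ω → ℝ} (h : IsRegressionProcess μ S σ x ε)
    (a b : Fin p ⊕ Unit) (t : ℤ) :
    ∫ ω, joint x ε t ω a * joint x ε t ω b ∂μ = jointMoment S ((σ : ℝ) ^ 2) a b := by
  rcases a with a | a <;> rcases b with b | b
  · simpa [joint, jointMoment] using h.cov t a b
  · simpa [joint, jointMoment] using h.cov_error t a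
  · simpa [joint, jointMoment, mul_comm] using h.cov_error t b
  · have h1 : ∫ ω, ε t ω * ε t ω ∂μ = ∫ r, r * r ∂(gaussianReal 0 (σ ^ 2)) :=
      (h.law t).integral_comp (f := fun r : ℝ => r * r)
        (by fun_prop : Measurable fun r : ℝ => r * r).aestronglyMeasurable
    have h2 := variance_fun_id_gaussianReal (μ := 0) (v := σ ^ 2)
    rw [variance_eq_integral measurable_id'.aemeasurable] at h2
    simp only [integral_id_gaussianReal, sub_zero] at h2
    simp only [joint, jointMoment, Sum.elim_inr, Matrix.fromBlocks_apply₂₂, Matrix.of_apply]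
    rw [h1]
    simp_rw [← sq]
    rw [h2]
    simp

/-- This limit holds for every positive definite `S`; orthogonality only serves to evaluate it. -/
theorem IsRegressionProcess.tendstoInMeasure_sigmaT [IsProbabilityMeasure μ]
    {S : Matrix (Fin p) (Fin p) ℝ} {σ : ℝ≥0} {x : ℤ → Ω → Fin p → ℝ} {ε : ℤ → Ω → ℝ}
    (h : IsRegressionProcess μ S σ x ε) (hσ : 0 < σ) (hS : S.PosDef) (β₀ : Fin p → ℝ)
    {f : ℕ → ℝ} (hf : Tendsto (fun n : ℕ => f n / n) atTop (𝓝 0)) (i : Fin p) :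
    TendstoInMeasure μ (sigmaT f β₀ x ε i) atTop
      fun _ => totalVar (limitCrit β₀ S ((σ : ℝ) ^ 2)) i := by
  have hv : (0 : ℝ) < (σ : ℝ) ^ 2 := by positivity
  set V := jointMoment S ((σ : ℝ) ^ 2) with hV
  have hW : ∀ c : (Fin p ⊕ Unit) × (Fin p ⊕ Unit), TendstoInMeasure μ
      (fun (n : ℕ) ω => (n : ℝ)⁻¹ * ∑ t ∈ Finset.range n,
        joint x ε ((t : ℤ) + 1) ω c.1 * joint x ε ((t : ℤ) + 1) ω c.2)
      atTop fun _ => V c.1 c.2 := fun c =>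
    (h.linear.avgTendsto_mul (h.integral_joint_mul c.1 c.2)).tendstoInMeasure
  -- `Φ` depends on `n` only through the penalty, hence the joint limit in `n` and the moments.
  refine tendstoInMeasure_of_tendsto_prod hW (Φ := fun n w => totalVar (fun γ =>
    Real.log (momentResidVar β₀ (Matrix.of fun a b => w (a, b)) γ)
      + (numReg γ : ℝ) * (f n / n)) i) ?_ ?_
  · have hcrit : ∀ γ : Spec p, Tendsto (fun q : ℕ × ((Fin p ⊕ Unit) × (Fin p ⊕ Unit) → ℝ) =>
        Real.log (momentResidVar β₀ (Matrix.of fun a b => q.2 (a, b)) γ)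
          + (numReg γ : ℝ) * (f q.1 / q.1))
        (atTop ×ˢ 𝓝 fun c => V c.1 c.2) (𝓝 (limitCrit β₀ S ((σ : ℝ) ^ 2) γ)) := by
      intro γ
      have hlim : momentResidVar β₀ V γ = _ := momentResidVar_fromBlocks β₀ S ((σ : ℝ) ^ 2) γ
      have hcont : ContinuousAt (fun W => momentResidVar β₀ W γ) V := by
        refine continuousAt_momentResidVar β₀ ?_
        rw [hV, jointMoment, Matrix.toBlocks_fromBlocks₁₁]
        exact det_compression_ne_zero hS γ
      have hof : Continuous fun w : (Fin p ⊕ Unit) × (Fin p ⊕ Unit) → ℝ =>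
          (Matrix.of fun a b => w (a, b) : Matrix (Fin p ⊕ Unit) (Fin p ⊕ Unit) ℝ) :=
        continuous_matrix fun a b => continuous_apply (a, b)
      have h1 : Tendsto (fun w : (Fin p ⊕ Unit) × (Fin p ⊕ Unit) → ℝ =>
          momentResidVar β₀ (Matrix.of fun a b => w (a, b)) γ) (𝓝 fun c => V c.1 c.2)
          (𝓝 (momentResidVar β₀ V γ)) :=
        hcont.tendsto.comp (hof.tendsto fun c => V c.1 c.2)
      rw [hlim] at h1
      have h2 := (h1.log (limitCrit_arg_pos hS hv γ).ne').comp
        (tendsto_snd (f := (atTop : Filter ℕ)))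
      have h3 := (hf.const_mul (numReg γ : ℝ)).comp
        (tendsto_fst (f := (atTop : Filter ℕ)) (g := 𝓝 fun c : (Fin p ⊕ Unit) × (Fin p ⊕ Unit) => V c.1 c.2))
      rw [mul_zero] at h3
      simpa [limitCrit] using h2.add h3
    simp_rw [totalVar_eq]
    exact (tendsto_finsetSum _ fun γ _ =>
      (((hcrit _).sub (hcrit _)).div_const 2).pow 2).const_mul _
  · filter_upwards [eventually_ne_atTop 0] with n hn ω
    rw [sigmaT]
    congr 1
    funext γ
    rw [infoCrit, response, residVar_eq_momentResidVar hn β₀ (design x n ω)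
      (fun t : Fin n => ε ((t : ℤ) + 1) ω)
      (Matrix.of fun (t : Fin n) a => joint x ε ((t : ℤ) + 1) ω a)
      (fun _ _ => rfl) (fun _ => rfl)]
    congr 3
    ext a b
    simp [Matrix.mul_apply, Finset.sum_range]

end Limits

end RegGSA

theorem mainTheorem2 (p : ℕ) (β₀ : Fin p → ℝ) (S : Matrix (Fin p) (Fin p) ℝ) (σ : ℝ≥0)
    (hσ : 0 < σ) (hS : S.PosDef)
    (horth : ∀ j l : Fin p, β₀ j ≠ 0 → β₀ l = 0 → S l j = 0) :
    ∃ c : Fin p → ℝ, (∀ i, β₀ i ≠ 0 → 0 < c i) ∧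
      ∀ (Ω : Type*) [MeasurableSpace Ω] (μ : Measure Ω) [IsProbabilityMeasure μ]
        (x : ℤ → Ω → Fin p → ℝ) (ε : ℤ → Ω → ℝ),
        RegGSA.IsRegressionProcess μ S σ x ε →
        ∀ f : ℕ → ℝ, Tendsto (fun n : ℕ => f n / n) atTop (𝓝 0) →
          (∀ i, β₀ i = 0 →
            TendstoInMeasure μ (RegGSA.sigmaT f β₀ x ε i) atTop fun _ => 0) ∧
          (∀ i, β₀ i ≠ 0 →
            TendstoInMeasure μ (RegGSA.sigmaT f β₀ x ε i) atTop fun _ => c i) := by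
  -- The constants are built from `β₀`, `S` and `σ` alone, so they precede the choice of probability
  -- space, process and penalty.
  refine ⟨RegGSA.totalVar (RegGSA.limitCrit β₀ S ((σ : ℝ) ^ 2)),
    fun i hi => RegGSA.totalVar_limitCrit_pos hS (by positivity) hi, ?_⟩
  intro Ω _ μ _ x ε h f hf
  refine ⟨fun i hi => ?_, fun i _ => h.tendstoInMeasure_sigmaT hσ hS β₀ hf i⟩
  have := h.tendstoInMeasure_sigmaT hσ hS β₀ hf i
  rwa [RegGSA.totalVar_limitCrit_eq_zero hS horth _ hi] at this
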